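/- Let $q$ be a prime power, let $X\subseteq\mathbb P^2$ be the Hermitian curve $y^qz+yz^q=x^{q+1}$ over $\mathbb F_{q^2}$, let $P_\infty=(0:1:0)$ and $B=X(\mathbb F_{q^2})\setminus\{P_\infty\}$. For integers $d,a>0$ let $C(d,a)\subseteq\mathbb F_{q^2}^{B}$ be the code obtained by evaluating at the points $(x:y:1)$ of $B$ the vector space $H^0(X,\mathcal O_X(d)(-aP_\infty))$ of the homogeneous forms of degree $d$ on $X$ that vanish on the scheme $aP_\infty$. For a subset $H\subseteq B$ let $C(d,a,H)\subseteq\mathbb F_{q^2}^{B\setminus H}$ be the code obtained by evaluating the same space on $B\setminus H$ only; equivalently, the projection $\pi_H(C(d,a))$ that deletes the coordinates in $H$. A non-empty subset $H\subseteq B$ is called an improving subset for $C(d,a)^\perp$ if the minimum distance of $\pi_H(C(d,a))^\perp$ is strictly greater than the minimum distance of $C(d,a)^\perp$, where the minimum distance of the zero code is $\infty$. Let $0<d<q$ and $1\le a\le d$ be integers. A non-empty subset $H\subseteq B$ is an improving subset for $C(d,a)^\perp$ if and only if there are no $d+1$ distinct points of $B\setminus H$ lying on a common line of $\mathbb P^2$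 through $P_\infty$. In particular, if $H$ is an improving subset for $C(d,a)^\perp$, then $\sharp H\ge q^2(q-d)$, and so the length of $C(d,a,H)^\perp$ is at most $q^2d$. -/

import Mathlib

open scoped LinearAlgebra.Projectivization

noncomputable section

/-! ### Linear codes -/

namespace LinCode

variable {K ι : Type*} [Field K]

/-- The length of a code `C ⊆ K^ι`: the number of coordinates. -/
def length (_C : Submodule K (ι → K)) : ℕ := Nat.card ι

open Classical in
/-- The minimum distance of a code: the least Hamming distance between two distinct codewords.
It takes values in `ℕ∞`, and the minimum distance of the zero code is `∞`. -/
def minDist [Fintype ι] (C : Submodule K (ι → K)) : ℕ∞ :=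
  ⨅ v ∈ C, ⨅ w ∈ C, ⨅ (_ : v ≠ w), (hammingDist v w : ℕ∞)

/-- The dual code `C^⊥`, with respect to the product `v · w = ∑ v_i w_i`. -/
def dual [Fintype ι] (C : Submodule K (ι → K)) : Submodule K (ι → K) where
  carrier := {v | ∀ c ∈ C, v ⬝ᵥ c = 0}
  add_mem' {v w} hv hw c hc := by rw [add_dotProduct, hv c hc, hw c hc, add_zero]
  zero_mem' c _ := zero_dotProduct c
  smul_mem' r v hv c hc := by rw [smul_dotProduct, hv c hc, smul_zero]

/-- The projection `π_H` deleting the coordinates whose index lies in `H`. -/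
def proj (K : Type*) [Field K] (H : Set ι) : (ι → K) →ₗ[K] ({i // i ∉ H} → K) :=
  LinearMap.funLeft K K Subtype.val

open Classical in
/-- `H` is an improving subset for `C^⊥`: it is a non-empty set of coordinates such that the
minimum distance of `π_H(C)^⊥` is strictly greater than that of `C^⊥`. -/
def IsImprovingSubset [Fintype ι] (C : Submodule K (ι → K)) (H : Set ι) : Prop :=
  H.Nonempty ∧ minDist (dual C) < minDist (dual (C.map (proj K H)))

end LinCode

/-! ### The Hermitian curve and the codes `C(d,a)`, `C(d,a,H)` -/

namespace Hermitian

open MvPolynomial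

/-- Homogeneous equation `y^q z + y z^q - x^(q+1)` of the Hermitian curve `X`; the homogeneous
coordinates `x, y, z` of the plane are indexed by `0, 1, 2`. -/
def curve (K : Type*) [Field K] (q : ℕ) : MvPolynomial (Fin 3) K :=
  X 1 ^ q * X 2 + X 1 * X 2 ^ q - X 0 ^ (q + 1)

/-- The set `X(K)` of `K`-rational points of the Hermitian curve in the projective plane. -/
def points (K : Type*) [Field K] (q : ℕ) : Set (ℙ K (Fin 3 → K)) :=
  {P | eval P.rep (curve K q) = 0}

/-- The point `P_∞ = (0 : 1 : 0)`. -/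
def Pinfty (K : Type*) [Field K] : ℙ K (Fin 3 → K) :=
  Projectivization.mk K ![0, 1, 0] fun h => one_ne_zero (congrFun h 1)

/-- The evaluation set `B = X(K) \ {P_∞}`. -/
def B (K : Type*) [Field K] (q : ℕ) : Set (ℙ K (Fin 3 → K)) := points K q \ {Pinfty K}

instance instFintypeB (K : Type*) [Field K] [Finite K] (q : ℕ) : Fintype (B K q) :=
  Fintype.ofFinite _

/-- Restriction of a form `f(x, y, z)` to the affine chart `y ≠ 0`, i.e. the polynomial
`f(x, 1, z)` in the affine coordinates `x, z`, indexed by `0, 1`. The point `P_∞` is the origin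
of this chart. -/
def chart (K : Type*) [Field K] : MvPolynomial (Fin 3) K →ₐ[K] MvPolynomial (Fin 2) K :=
  aeval ![X 0, 1, X 1]

/-- The ideal, in the chart `y ≠ 0`, of the divisor `aP_∞` of `X` regarded as a closed subscheme
of the plane: the ideal generated by the equation of `X` and by the `a`-th power of the maximal
ideal of `P_∞`. As this ideal is primary to the maximal ideal of `P_∞` (or the unit ideal when
`a = 0`), belonging to it is a condition in the local ring of `X` at `P_∞` only, namely
vanishing to order at least `a`. -/
def idealE (K : Type*) [Field K] (q a : ℕ) : Ideal (MvPolynomial (Fin 2) K) :=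
  Ideal.span {chart K (curve K q)} ⊔ Ideal.span {X 0, X 1} ^ a

/-- Homogeneous forms of degree `d` which, restricted to `X`, vanish on the scheme `E = aP_∞`.
Restricting them to `X` gives all of `H^0(X, O_X(d)(-aP_∞))`. -/
def forms (K : Type*) [Field K] (q d a : ℕ) : Submodule K (MvPolynomial (Fin 3) K) :=
  homogeneousSubmodule (Fin 3) K d ⊓
    ((idealE K q a).restrictScalars K).comap (chart K).toLinearMap

/-- The representative `(x, y, 1)` of a point of the affine chart `z ≠ 0`, which contains `B`. -/
def affineRep {K : Type*} [Field K] (P : ℙ K (Fin 3 → K)) : Fin 3 → K :=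
  fun i => P.rep i / P.rep 2

/-- Evaluation of polynomials at a family of points of the chart `z ≠ 0`. -/
def evalAt {K ι : Type*} [Field K] (pt : ι → ℙ K (Fin 3 → K)) :
    MvPolynomial (Fin 3) K →ₗ[K] (ι → K) :=
  LinearMap.pi fun i => (aeval (affineRep (pt i))).toLinearMap

/-- The code `C(d,a)`, obtained evaluating `H^0(X, O_X(d)(-aP_∞))` on `B`. -/
def code (K : Type*) [Field K] (q d a : ℕ) : Submodule K (B K q → K) :=
  (forms K q d a).map (evalAt fun P : B K q => (P : ℙ K (Fin 3 → K)))

/-- The code `C(d,a,H)`, obtained evaluating `H^0(X, O_X(d)(-aP_∞))` on `B \ H`. -/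
def codeH {K : Type*} [Field K] (q d a : ℕ) (H : Set (B K q)) :
    Submodule K ({P : B K q // P ∉ H} → K) :=
  (forms K q d a).map (evalAt fun P : {P : B K q // P ∉ H} => (P.1 : ℙ K (Fin 3 → K)))

/-- There are `m` distinct points of `B \ H` lying on a common projective line through `P_∞`. -/
def HasCollinear {K : Type*} [Field K] (q m : ℕ) (H : Set (B K q)) : Prop :=
  ∃ L : Submodule K (Fin 3 → K), Module.finrank K L = 2 ∧ Pinfty K ∈ L.projectivization ∧
    ∃ S : Finset (B K q), S.card = m ∧
      ∀ P ∈ S, P ∉ H ∧ (P : ℙ K (Fin 3 → K)) ∈ L.projectivization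

end Hermitian

end

/-!
Since `z` vanishes to order `q + 1` at `P_∞`, the space of forms contains every multiple of `z` and
every product of `d` lines through `P_∞`; on the other hand, none of its members has a `y^d` term.
The multiples of `z` and the products of lines separate any point of `B` from `d` others, unless
all `d + 1` points lie on one line through `P_∞`, so these are the only possible supports of a
nonzero word of weight at most `d + 1` in `C(d,a)^⊥`. Conversely, on a line `x = c z` the forms
restrict to polynomials in `y` of degree less than `d`, and the barycentric weights of `d + 1` nodes
are orthogonal to all of those. Hence the minimum distance is `d + 1`, its words are supported
exactly on the collinear `(d + 1)`-tuples, and deleting `H` removes a word from the dual precisely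
when `H` meets its support. Each of the `q^2` lines `x = c z` carries `q` points of `B`.
-/

namespace LinCode

variable {K ι : Type*} [Field K] {H : Set ι}

theorem exists_proj_eq (w : {i // i ∉ H} → K) :
    ∃ v : ι → K, (∀ i ∈ H, v i = 0) ∧ proj K H v = w :=
  ⟨Function.extend Subtype.val w 0,
    fun _ hi => Function.extend_apply' _ _ _ fun ⟨j, hj⟩ => j.2 (hj ▸ hi),
    funext (Subtype.val_injective.extend_apply _ _)⟩

variable [Fintype ι] {C : Submodule K (ι → K)}

theorem le_minDist_iff [DecidableEq K] {n : ℕ∞} :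
    n ≤ minDist C ↔ ∀ v ∈ C, v ≠ 0 → n ≤ (hammingNorm v : ℕ∞) := by
  have hdist (v w : ι → K) : @hammingDist ι _ _ (fun _ => Classical.decEq K) v w =
      hammingNorm (-v + w) := by
    rw [← hammingDist_eq_hammingNorm]
    congr
  simp only [minDist, le_iInf_iff, hdist]
  constructor
  · intro h v hv hv0
    simpa only [neg_zero, zero_add] using h 0 C.zero_mem v hv hv0.symm
  · intro h v hv w hw hvw
    exact h _ (C.add_mem (C.neg_mem hv) hw) fun h0 => hvw (neg_add_eq_zero.1 h0)

theorem apply_eq_zero_of_mem_dual {v c : ι → K} (hv : v ∈ dual C) (hc : c ∈ C) {i : ι}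
    (hci : c i ≠ 0) (h : ∀ j ≠ i, v j ≠ 0 → c j = 0) : v i = 0 := by
  have hsum : ∑ j, v j * c j = v i * c i :=
    Fintype.sum_eq_single i fun j hj => by
      by_cases hvj : v j = 0
      · rw [hvj, zero_mul]
      · rw [h j hj hvj, mul_zero]
  exact (mul_eq_zero.1 (hsum.symm.trans (hv c hc))).resolve_right hci

section DeletedCode

variable [Fintype {i // i ∉ H}]

theorem sum_proj {M : Type*} [AddCommMonoid M] {f : ι → M} (hf : ∀ i ∈ H, f i = 0) :
    ∑ i : {i // i ∉ H}, f i = ∑ i, f i :=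
  Fintype.sum_of_injective Subtype.val Subtype.val_injective _ _
    (fun i hi => hf i <| by simpa using hi) fun _ => rfl

theorem hammingNorm_proj [DecidableEq K] {v : ι → K} (hv : ∀ i ∈ H, v i = 0) :
    hammingNorm (proj K H v) = hammingNorm v := by
  simp only [hammingNorm, Finset.card_filter]
  exact sum_proj fun i hi => if_neg (not_not.2 (hv i hi))

theorem proj_mem_dual_iff {v : ι → K} (hv : ∀ i ∈ H, v i = 0) :
    proj K H v ∈ dual (C.map (proj K H)) ↔ v ∈ dual C := by
  have hdot (c : ι → K) : proj K H v ⬝ᵥ proj K H c = v ⬝ᵥ c :=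
    sum_proj (f := fun i => v i * c i) fun i hi => by simp only [hv i hi, zero_mul]
  constructor
  · exact fun h c hc => (hdot c).symm.trans (h _ ⟨c, hc, rfl⟩)
  · rintro h _ ⟨c, hc, rfl⟩
    exact (hdot c).trans (h c hc)

theorem le_minDist_dual_proj_iff [DecidableEq K] {n : ℕ∞} :
    n ≤ minDist (dual (C.map (proj K H))) ↔
      ∀ v ∈ dual C, (∀ i ∈ H, v i = 0) → v ≠ 0 → n ≤ (hammingNorm v : ℕ∞) := by
  rw [le_minDist_iff]
  constructor
  · intro h v hv hvH hv0
    rw [← hammingNorm_proj hvH]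
    refine h _ ((proj_mem_dual_iff hvH).2 hv) ?_
    rwa [← hammingNorm_ne_zero_iff, hammingNorm_proj hvH, hammingNorm_ne_zero_iff]
  · intro h w hw hw0
    obtain ⟨v, hvH, rfl⟩ := exists_proj_eq w
    rw [hammingNorm_proj hvH]
    refine h v ((proj_mem_dual_iff hvH).1 hw) hvH ?_
    rintro rfl
    exact hw0 (map_zero _)

end DeletedCode

theorem isImprovingSubset_iff_of_minDist_eq [DecidableEq K] {n : ℕ} (hn : minDist (dual C) = n)
    (hH : H.Nonempty) :
    IsImprovingSubset C H ↔ ∀ v ∈ dual C, v ≠ 0 → hammingNorm v = n → ∃ i ∈ H, v i ≠ 0 := by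
  classical
  have hmin (v : ι → K) (hv : v ∈ dual C) (hv0 : v ≠ 0) : n ≤ hammingNorm v :=
    Nat.cast_le.1 (le_minDist_iff.1 hn.ge v hv hv0)
  rw [IsImprovingSubset, and_iff_right hH, hn, ← ENat.add_one_le_iff (ENat.natCast_ne_top n),
    le_minDist_dual_proj_iff]
  constructor
  · intro h v hv hv0 hvn
    by_contra! hvH
    have hlt : n + 1 ≤ hammingNorm v := by exact_mod_cast h v hv hvH hv0
    omega
  · intro h v hv hvH hv0
    have hne : hammingNorm v ≠ n := fun hvn =>
      let ⟨i, hi, hvi⟩ := h v hv hv0 hvn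
      hvi (hvH i hi)
    exact_mod_cast (hmin v hv hv0).lt_of_ne hne.symm

end LinCode

namespace Hermitian

open MvPolynomial
open scoped Finset

section HomogeneousForms

variable {K σ ι : Type*} [Field K]

theorem eval_piSingle_eq_coeff [DecidableEq σ] {f : MvPolynomial σ K} {n : ℕ}
    (hf : f.IsHomogeneous n) (i : σ) :
    eval (Pi.single i 1) f = f.coeff (Finsupp.single i n) := by
  rw [eval_eq, Finset.sum_eq_single (Finsupp.single i n)]
  · rw [Finset.prod_eq_one, mul_one]
    intro j hj
    obtain rfl : j = i := by simpa using Finsupp.support_single_subset hj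
    simp
  · intro s hs hne
    obtain ⟨j, hj, hji⟩ : ∃ j ∈ s.support, j ≠ i := by
      by_contra! hsub
      obtain ⟨m, rfl⟩ := Finsupp.support_subset_singleton'.1
        fun j hj => Finset.mem_singleton.2 (hsub j hj)
      have hdeg : n = (Finsupp.single i m).degree := hf.degree_eq_sum_deg_support hs
      exact hne (by rw [hdeg, Finsupp.degree_single])
    rw [Finset.prod_eq_zero hj, mul_zero]
    rw [Pi.single_eq_of_ne hji, zero_pow (Finsupp.mem_support_iff.1 hj)]
  · intro hs
    rw [notMem_support_iff.1 hs, zero_mul]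

theorem exists_linearForm_eval_ne_zero [Finite σ] {W : Submodule K (σ → K)} {p : σ → K}
    (hp : p ∉ W) : ∃ g : MvPolynomial σ K,
      g.IsHomogeneous 1 ∧ (∀ w ∈ W, eval w g = 0) ∧ eval p g ≠ 0 := by
  classical
  have := Fintype.ofFinite σ
  obtain ⟨φ, hφp, hφW⟩ := Submodule.exists_le_ker_of_notMem hp
  let g : MvPolynomial σ K := ∑ i, C (φ fun j => if i = j then 1 else 0) * X i
  have heval (w : σ → K) : eval w g = φ w := by
    rw [φ.pi_apply_eq_sum_univ w]
    simp [g, mul_comm]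
  refine ⟨g, IsHomogeneous.sum _ _ _ fun i _ => isHomogeneous_C_mul_X _ i, fun w hw => ?_, ?_⟩
  · rw [heval, hφW hw]
  · rwa [heval]

theorem exists_form_eval_ne_zero [Finite σ] {T : Finset ι} {W : ι → Submodule K (σ → K)}
    {p : σ → K} (hp : ∀ t ∈ T, p ∉ W t) : ∃ g : MvPolynomial σ K,
      g.IsHomogeneous #T ∧ (∀ t ∈ T, ∀ w ∈ W t, eval w g = 0) ∧ eval p g ≠ 0 := by
  choose! g hhom hzero hne using fun t ht => exists_linearForm_eval_ne_zero (hp t ht)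
  refine ⟨∏ t ∈ T, g t, ?_, fun t ht w hw => ?_, ?_⟩
  · simpa using IsHomogeneous.prod T g (fun _ => 1) hhom
  · rw [map_prod]
    exact Finset.prod_eq_zero ht (hzero t ht w hw)
  · rw [map_prod]
    exact Finset.prod_ne_zero_iff.2 hne

end HomogeneousForms

section AffineCoordinates

variable {K : Type*} [Field K] {q : ℕ}

/-- The coordinate `x` of a point `P = (x : y : 1)` of `B`. -/
noncomputable def xCoord (P : B K q) : K := affineRep P.1 0

/-- The coordinate `y` of a point `P = (x : y : 1)` of `B`. -/
noncomputable def yCoord (P : B K q) : K := affineRep P.1 1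

theorem eval_curve (v : Fin 3 → K) :
    eval v (curve K q) = v 1 ^ q * v 2 + v 1 * v 2 ^ q - v 0 ^ (q + 1) := by
  simp [curve]

theorem rep_two_ne_zero (hq : q ≠ 0) (P : B K q) : P.1.rep 2 ≠ 0 := by
  obtain ⟨P, hP, hPinf⟩ := P
  intro (h2 : P.rep 2 = 0)
  have h0 : P.rep 0 = 0 := by
    have hcurve : eval P.rep (curve K q) = 0 := hP
    simpa [eval_curve, h2, hq] using hcurve
  apply hPinf
  rw [Set.mem_singleton_iff, ← P.mk_rep, Pinfty, Projectivization.mk_eq_mk_iff']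
  refine ⟨P.rep 1, funext fun i => ?_⟩
  fin_cases i <;> simp [h0, h2]

theorem affineRep_eq_smul_rep (P : ℙ K (Fin 3 → K)) : affineRep P = (P.rep 2)⁻¹ • P.rep :=
  funext fun _ => div_eq_inv_mul _ _

theorem affineRep_mk {v : Fin 3 → K} (hv : v ≠ 0) :
    affineRep (Projectivization.mk K v hv) = (v 2)⁻¹ • v := by
  obtain ⟨a, ha⟩ := Projectivization.exists_smul_eq_mk_rep K v hv
  rw [affineRep_eq_smul_rep, ← ha]
  funext i
  simp [Units.smul_def]
  field_simp

theorem affineRep_eq (hq : q ≠ 0) (P : B K q) : affineRep P.1 = ![xCoord P, yCoord P, 1] := by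
  funext i
  fin_cases i
  · rfl
  · rfl
  · exact div_self (rep_two_ne_zero hq P)

theorem eq_of_affineRep_eq (hq : q ≠ 0) {P Q : B K q} (h : affineRep P.1 = affineRep Q.1) :
    P = Q := by
  have hmem : Submodule.span K {P.1.rep} = Submodule.span K {Q.1.rep} := by
    have hspan (R : B K q) : Submodule.span K {affineRep R.1} = Submodule.span K {R.1.rep} := by
      rw [affineRep_eq_smul_rep]
      exact Submodule.span_singleton_smul_eq
        (IsUnit.mk0 _ (inv_ne_zero (rep_two_ne_zero hq R))) _
    rw [← hspan, h, hspan]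
  refine Subtype.ext (Projectivization.submodule_injective ?_)
  rwa [Projectivization.submodule_eq, Projectivization.submodule_eq]

theorem eq_of_coord_eq (hq : q ≠ 0) {P Q : B K q} (hx : xCoord P = xCoord Q)
    (hy : yCoord P = yCoord Q) : P = Q :=
  eq_of_affineRep_eq hq <| by rw [affineRep_eq hq, affineRep_eq hq, hx, hy]

theorem yCoord_pow_add_yCoord (hq : q ≠ 0) (P : B K q) :
    yCoord P ^ q + yCoord P = xCoord P ^ (q + 1) := by
  have h2 := rep_two_ne_zero hq P
  have hcurve : eval P.1.rep (curve K q) = 0 := P.2.1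
  rw [eval_curve] at hcurve
  simp only [xCoord, yCoord, affineRep, div_pow]
  field_simp
  linear_combination P.1.rep 2 ^ (q + 1) * hcurve

theorem exists_coord_eq {x y : K} (h : y ^ q + y = x ^ (q + 1)) :
    ∃ P : B K q, xCoord P = x ∧ yCoord P = y := by
  have hv : (![x, y, 1] : Fin 3 → K) ≠ 0 := fun h => one_ne_zero (congrFun h 2)
  have hcurve : Projectivization.mk K _ hv ∈ points K q := by
    obtain ⟨a, ha⟩ := Projectivization.exists_smul_eq_mk_rep K _ hv
    rw [points, Set.mem_ofPred_eq, ← ha, eval_curve]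
    simp only [Units.smul_def, Pi.smul_apply, smul_eq_mul, Matrix.cons_val]
    linear_combination (a : K) ^ (q + 1) * h
  have hPinf : Projectivization.mk K _ hv ∉ ({Pinfty K} : Set (ℙ K (Fin 3 → K))) := by
    rw [Set.mem_singleton_iff, Pinfty, Projectivization.mk_eq_mk_iff']
    rintro ⟨b, hb⟩
    simpa using congrFun hb 2
  refine ⟨⟨_, hcurve, hPinf⟩, ?_, ?_⟩ <;> simp [xCoord, yCoord, affineRep_mk]

theorem eq_of_affineRep_mem_span_singleton (hq : q ≠ 0) {P Q : B K q}
    (h : affineRep P.1 ∈ K ∙ affineRep Q.1) : P = Q := by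
  obtain ⟨a, ha⟩ := Submodule.mem_span_singleton.1 h
  have ha1 : a = 1 := by simpa [affineRep_eq hq] using congrFun ha 2
  rw [ha1, one_smul] at ha
  exact (eq_of_affineRep_eq hq ha).symm

theorem eq_of_affineRep_mem_span_pair (hq : q ≠ 0) {P Q R : B K q}
    (h : affineRep P.1 ∈ Submodule.span K {affineRep Q.1, affineRep R.1})
    (hQ : xCoord Q = xCoord P) (hR : xCoord R ≠ xCoord P) : P = Q := by
  obtain ⟨a, b, hab⟩ := Submodule.mem_span_pair.1 h
  have hx : a * xCoord Q + b * xCoord R = xCoord P := congrFun hab 0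
  have hz : a + b = 1 := by simpa [affineRep_eq hq] using congrFun hab 2
  have hb : b = 0 := by
    refine (mul_eq_zero.1 ?_).resolve_right (sub_ne_zero.2 hR)
    linear_combination hx - a * hQ - xCoord P * hz
  rw [hb, zero_smul, add_zero] at hab
  exact eq_of_affineRep_mem_span_singleton hq (Submodule.mem_span_singleton.2 ⟨a, hab⟩)

end AffineCoordinates

section LinesThroughPinfty

variable {K : Type*} [Field K] {q : ℕ}

/-- The projective line `x = c z` through `P_∞`, as a plane in `K^3`. The only other line through
`P_∞`, the line `z = 0`, contains no point of `B`. -/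
def verticalLine (c : K) : Submodule K (Fin 3 → K) :=
  LinearMap.ker (LinearMap.proj 0 - c • LinearMap.proj 2 : (Fin 3 → K) →ₗ[K] K)

theorem mem_verticalLine {c : K} {v : Fin 3 → K} : v ∈ verticalLine c ↔ v 0 = c * v 2 := by
  simp [verticalLine, sub_eq_zero]

theorem finrank_verticalLine (c : K) : Module.finrank K (verticalLine c) = 2 := by
  have hne : (LinearMap.proj 0 - c • LinearMap.proj 2 : (Fin 3 → K) →ₗ[K] K) ≠ 0 :=
    fun h => by simpa using LinearMap.congr_fun h ![1, 0, 0]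
  have := Module.Dual.finrank_ker_add_one_of_ne_zero hne
  rw [Module.finrank_fin_fun] at this
  exact Nat.succ_injective this

theorem Pinfty_mem_projectivization_iff {L : Submodule K (Fin 3 → K)} :
    Pinfty K ∈ L.projectivization ↔ ![0, 1, 0] ∈ L :=
  Submodule.mk_mem_projectivization_iff L _

theorem mem_projectivization_iff (hq : q ≠ 0) {L : Submodule K (Fin 3 → K)} {P : B K q} :
    P.1 ∈ L.projectivization ↔ affineRep P.1 ∈ L := by
  rw [affineRep_eq_smul_rep, L.smul_mem_iff (inv_ne_zero (rep_two_ne_zero hq P)),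
    ← Submodule.mk_mem_projectivization_iff L P.1.rep_nonzero, P.1.mk_rep]

theorem affineRep_mem_verticalLine_iff (hq : q ≠ 0) {P : B K q} {c : K} :
    affineRep P.1 ∈ verticalLine c ↔ xCoord P = c := by
  simp [mem_verticalLine, affineRep_eq hq]

theorem eq_verticalLine (hq : q ≠ 0) {L : Submodule K (Fin 3 → K)}
    (hL : Module.finrank K L = 2) (hinf : ![0, 1, 0] ∈ L) {P : B K q} (hP : affineRep P.1 ∈ L) :
    L = verticalLine (xCoord P) := by
  have hfinrank : Module.finrank K (verticalLine (xCoord P)) = Module.finrank K L := by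
    rw [finrank_verticalLine, hL]
  refine (Submodule.eq_of_le_of_finrank_eq (fun v hv => ?_) hfinrank).symm
  have hcomb : v 2 • affineRep P.1 + (v 1 - v 2 * yCoord P) • ![0, 1, 0] = v := by
    rw [mem_verticalLine] at hv
    rw [affineRep_eq hq]
    funext i
    fin_cases i <;> simp [hv, mul_comm]
  exact hcomb ▸ L.add_mem (L.smul_mem _ hP) (L.smul_mem _ hinf)

theorem hasCollinear_iff (hq : q ≠ 0) {m : ℕ} (hm : 0 < m) {H : Set (B K q)} :
    HasCollinear q m H ↔
      ∃ c : K, ∃ S : Finset (B K q), #S = m ∧ ∀ P ∈ S, P ∉ H ∧ xCoord P = c := by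
  constructor
  · rintro ⟨L, hL, hinf, S, hS, hSL⟩
    obtain ⟨P₀, hP₀⟩ : S.Nonempty := Finset.card_pos.1 (hS ▸ hm)
    have hLP₀ : L = verticalLine (xCoord P₀) :=
      eq_verticalLine hq hL (Pinfty_mem_projectivization_iff.1 hinf)
        ((mem_projectivization_iff hq).1 (hSL P₀ hP₀).2)
    refine ⟨xCoord P₀, S, hS, fun P hP => ⟨(hSL P hP).1, ?_⟩⟩
    rw [← affineRep_mem_verticalLine_iff hq, ← hLP₀, ← mem_projectivization_iff hq]
    exact (hSL P hP).2
  · rintro ⟨c, S, hS, hSc⟩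
    refine ⟨verticalLine c, finrank_verticalLine c, ?_, S, hS, fun P hP => ⟨(hSc P hP).1, ?_⟩⟩
    · rw [Pinfty_mem_projectivization_iff]
      simp [mem_verticalLine]
    · rw [mem_projectivization_iff hq, affineRep_mem_verticalLine_iff hq]
      exact (hSc P hP).2

end LinesThroughPinfty

section Separation

variable {K : Type*} [Field K] {q d a : ℕ}

theorem mem_forms {f : MvPolynomial (Fin 3) K} :
    f ∈ forms K q d a ↔ f.IsHomogeneous d ∧ chart K f ∈ idealE K q a := Iff.rfl

/-- In the chart `y ≠ 0` the curve reads `z = x^(q+1) - z^q`. -/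
theorem X_one_mem_idealE (haq : a ≤ q) : (X 1 : MvPolynomial (Fin 2) K) ∈ idealE K q a := by
  have hcurve : (X 1 : MvPolynomial (Fin 2) K) =
      chart K (curve K q) + (X 0 ^ (q + 1) - X 1 ^ q) := by
    simp [chart, curve]
  have hpow (i : Fin 2) {n : ℕ} (hn : a ≤ n) :
      (X i : MvPolynomial (Fin 2) K) ^ n ∈ Ideal.span {X 0, X 1} ^ a := by
    refine Ideal.pow_le_pow_right hn (Ideal.pow_mem_pow (Ideal.subset_span ?_) n)
    fin_cases i <;> simp
  rw [hcurve]
  exact add_mem (Ideal.mem_sup_left (Ideal.mem_span_singleton_self _))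
    (Ideal.mem_sup_right (sub_mem (hpow 0 (haq.trans q.le_succ)) (hpow 1 haq)))

theorem mul_X_two_pow_mem_forms (haq : a ≤ q) {m : ℕ} {g : MvPolynomial (Fin 3) K}
    (hg : g.IsHomogeneous m) (hm : m < d) : g * X 2 ^ (d - m) ∈ forms K q d a := by
  refine mem_forms.2 ⟨?_, ?_⟩
  · simpa only [Nat.add_sub_cancel' hm.le] using hg.mul (isHomogeneous_X_pow 2 (d - m))
  · have hchart : chart K (g * X 2 ^ (d - m)) = chart K g * X 1 ^ (d - m) := by simp [chart]
    rw [hchart]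
    exact Ideal.mul_mem_left _ _
      (Ideal.pow_mem_of_mem _ (X_one_mem_idealE haq) _ (Nat.sub_pos_of_lt hm))

theorem prod_X_zero_sub_mem_forms {ι : Type*} {T : Finset ι} (hT : #T = d) (had : a ≤ d)
    (c : ι → K) : ∏ t ∈ T, (X 0 - C (c t) * X 2) ∈ forms K q d a := by
  refine mem_forms.2 ⟨?_, Ideal.mem_sup_right (Ideal.pow_le_pow_right had ?_)⟩
  · simpa [hT] using IsHomogeneous.prod T (fun t => X 0 - C (c t) * X 2) (fun _ => 1)
      fun t _ => (isHomogeneous_X K 0).sub (isHomogeneous_C_mul_X (c t) 2)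
  · rw [map_prod, ← hT, ← Finset.prod_const]
    refine Ideal.prod_mem_prod fun t _ => ?_
    have hchart : chart K (X 0 - C (c t) * X 2) = X 0 - C (c t) * X 1 := by simp [chart]
    rw [hchart]
    exact sub_mem (Ideal.subset_span (by simp))
      (Ideal.mul_mem_left _ _ (Ideal.subset_span (by simp)))

/-- `f` separates `P` from `T`: it vanishes on `T` but not at `P`. -/
def Separates (f : MvPolynomial (Fin 3) K) (P : B K q) (T : Finset (B K q)) : Prop :=
  (∀ Q ∈ T, eval (affineRep Q.1) f = 0) ∧ eval (affineRep P.1) f ≠ 0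

theorem exists_mem_forms_separates_of_card_lt_of_cover (hq : q ≠ 0) (haq : a ≤ q)
    {P : B K q} {T T' : Finset (B K q)} (hT' : #T' < d)
    {W : B K q → Submodule K (Fin 3 → K)} (hW : ∀ R ∈ T', affineRep P.1 ∉ W R)
    (hcover : ∀ Q ∈ T, ∃ R ∈ T', affineRep Q.1 ∈ W R) :
    ∃ f ∈ forms K q d a, Separates f P T := by
  obtain ⟨g, hg, hgW, hgP⟩ := exists_form_eval_ne_zero hW
  refine ⟨_, mul_X_two_pow_mem_forms haq hg hT', fun Q hQ => ?_, ?_⟩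
  · obtain ⟨R, hR, hQR⟩ := hcover Q hQ
    rw [map_mul, hgW R hR _ hQR, zero_mul]
  · simpa [affineRep_eq hq] using hgP

theorem exists_mem_forms_separates_of_card_lt (hq : q ≠ 0) (haq : a ≤ q) {P : B K q}
    {T : Finset (B K q)} (hP : P ∉ T) (hT : #T < d) : ∃ f ∈ forms K q d a, Separates f P T :=
  exists_mem_forms_separates_of_card_lt_of_cover hq haq hT (W := fun Q => K ∙ affineRep Q.1)
    (fun _ hR hPR => hP (eq_of_affineRep_mem_span_singleton hq hPR ▸ hR))
    fun Q hQ => ⟨Q, hQ, Submodule.mem_span_singleton_self _⟩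

/-- The line through `Q` and `R` misses `P` and covers two points of `T` at once, which leaves room
for a factor `z`. -/
theorem exists_mem_forms_separates_of_xCoord_eq (hq : q ≠ 0) (haq : a ≤ q) {P Q R : B K q}
    {T : Finset (B K q)} (hP : P ∉ T) (hT : #T = d) (hQ : Q ∈ T) (hxQ : xCoord Q = xCoord P)
    (hR : R ∈ T) (hxR : xCoord R ≠ xCoord P) : ∃ f ∈ forms K q d a, Separates f P T := by
  classical
  refine exists_mem_forms_separates_of_card_lt_of_cover hq haq (T' := T.erase Q)
    (W := Function.update (fun S => K ∙ affineRep S.1) R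
      (Submodule.span K {affineRep Q.1, affineRep R.1}))
    (hT ▸ Finset.card_erase_lt_of_mem hQ) (fun S hS hPS => ?_) fun S hS => ?_
  · obtain rfl | hSR := eq_or_ne S R
    · rw [Function.update_self] at hPS
      exact hP (eq_of_affineRep_mem_span_pair hq hPS hxQ hxR ▸ hQ)
    · rw [Function.update_of_ne hSR] at hPS
      exact hP (eq_of_affineRep_mem_span_singleton hq hPS ▸ Finset.mem_of_mem_erase hS)
  · have hRQ : R ∈ T.erase Q := Finset.mem_erase.2 ⟨fun h => hxR (h ▸ hxQ), hR⟩
    by_cases hSQR : S = Q ∨ S = R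
    · refine ⟨R, hRQ, ?_⟩
      rw [Function.update_self]
      exact Submodule.subset_span (hSQR.imp
        (congrArg fun U : B K q => affineRep U.1) (congrArg fun U : B K q => affineRep U.1))
    · push Not at hSQR
      refine ⟨S, Finset.mem_erase.2 ⟨hSQR.1, hS⟩, ?_⟩
      rw [Function.update_of_ne hSQR.2]
      exact Submodule.mem_span_singleton_self _

theorem exists_mem_forms_separates_of_xCoord_ne (hq : q ≠ 0) (had : a ≤ d) {P : B K q}
    {T : Finset (B K q)} (hT : #T = d) (hx : ∀ Q ∈ T, xCoord Q ≠ xCoord P) :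
    ∃ f ∈ forms K q d a, Separates f P T := by
  have heval (R : B K q) : eval (affineRep R.1) (∏ Q ∈ T, (X 0 - C (xCoord Q) * X 2)) =
      ∏ Q ∈ T, (xCoord R - xCoord Q) := by
    simp [map_prod, affineRep_eq hq]
  refine ⟨_, prod_X_zero_sub_mem_forms hT had xCoord, fun Q hQ => ?_, ?_⟩
  · rw [heval]
    exact Finset.prod_eq_zero hQ (sub_self _)
  · rw [heval]
    exact Finset.prod_ne_zero_iff.2 fun Q hQ => sub_ne_zero.2 (hx Q hQ).symm

theorem exists_mem_forms_separates (hq : q ≠ 0) (haq : a ≤ q) (had : a ≤ d) {P : B K q}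
    {T : Finset (B K q)} (hP : P ∉ T) (hT : #T ≤ d)
    (hvert : #T = d → ∃ Q ∈ T, xCoord Q ≠ xCoord P) : ∃ f ∈ forms K q d a, Separates f P T := by
  obtain hlt | hTd := hT.lt_or_eq
  · exact exists_mem_forms_separates_of_card_lt hq haq hP hlt
  by_cases hx : ∀ Q ∈ T, xCoord Q ≠ xCoord P
  · exact exists_mem_forms_separates_of_xCoord_ne hq had hTd hx
  · push Not at hx
    obtain ⟨Q, hQ, hxQ⟩ := hx
    obtain ⟨R, hR, hxR⟩ := hvert hTd
    exact exists_mem_forms_separates_of_xCoord_eq hq haq hP hTd hQ hxQ hR hxR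

end Separation

section VerticalWords

variable {K : Type*} [Field K] {q d a : ℕ}

theorem eval_Pinfty_eq_zero_of_mem_forms (hq : q ≠ 0) (ha : a ≠ 0) {f : MvPolynomial (Fin 3) K}
    (hf : f ∈ forms K q d a) : eval (Pi.single 1 1) f = 0 := by
  have hle : idealE K q a ≤ RingHom.ker (eval (0 : Fin 2 → K)) := by
    refine sup_le ?_ ((Ideal.pow_le_self ha).trans ?_)
    · rw [Ideal.span_singleton_le_iff_mem, RingHom.mem_ker]
      simp [chart, curve, hq]
    · rw [Ideal.span_le]
      rintro _ (rfl | rfl) <;> simp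
  have hchart : (aeval (0 : Fin 2 → K)).comp (chart K) = aeval (Pi.single 1 1) := by
    ext i
    fin_cases i <;> simp [chart]
  exact (AlgHom.congr_fun hchart f).symm.trans (hle hf.2)

theorem apply_one_lt_of_mem_support (hq : q ≠ 0) (ha : a ≠ 0) {f : MvPolynomial (Fin 3) K}
    (hf : f ∈ forms K q d a) {s : Fin 3 →₀ ℕ} (hs : s ∈ f.support) : s 1 < d := by
  have hdeg : s.degree = d := hf.1.degree_eq_sum_deg_support hs |>.symm
  rw [Finsupp.degree_eq_sum, Fin.sum_univ_three] at hdeg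
  by_contra! hds
  have hsingle : s = Finsupp.single 1 d := by
    ext i
    fin_cases i <;> simp <;> omega
  rw [mem_support_iff, hsingle, ← eval_piSingle_eq_coeff hf.1] at hs
  exact hs (eval_Pinfty_eq_zero_of_mem_forms hq ha hf)

theorem sum_nodalWeight_mul_pow_eq_zero {ι : Type*} [DecidableEq ι] {S : Finset ι} {y : ι → K}
    (hy : Set.InjOn y S) {m : ℕ} (hm : m + 1 < #S) :
    ∑ i ∈ S, Lagrange.nodalWeight S y i * y i ^ m = 0 := by
  have hdeg : (Polynomial.X ^ m : Polynomial K).degree < #S := by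
    rw [Polynomial.degree_X_pow]
    exact_mod_cast m.lt_succ_self.trans hm
  have hcoeff := Lagrange.coeff_eq_sum hy hdeg
  rw [Polynomial.coeff_X_pow, if_neg (by omega)] at hcoeff
  rw [hcoeff]
  refine Finset.sum_congr rfl fun i _ => ?_
  rw [Polynomial.eval_pow, Polynomial.eval_X, Lagrange.nodalWeight, Finset.prod_inv_distrib,
    div_eq_inv_mul]

theorem sum_nodalWeight_mul_eval_eq_zero [DecidableEq (B K q)] (hq : q ≠ 0) (ha : a ≠ 0) {c : K}
    {S : Finset (B K q)} (hS : #S = d + 1) (hSc : ∀ P ∈ S, xCoord P = c)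
    (hinj : Set.InjOn yCoord (S : Set (B K q))) {f : MvPolynomial (Fin 3) K}
    (hf : f ∈ forms K q d a) :
    ∑ P ∈ S, Lagrange.nodalWeight S yCoord P * eval (affineRep P.1) f = 0 := by
  have heval (P : B K q) (hP : P ∈ S) : eval (affineRep P.1) f =
      ∑ s ∈ f.support, f.coeff s * c ^ s 0 * yCoord P ^ s 1 := by
    simp [eval_eq', affineRep_eq hq, Fin.prod_univ_three, hSc P hP, mul_assoc]
  calc ∑ P ∈ S, Lagrange.nodalWeight S yCoord P * eval (affineRep P.1) f
      = ∑ P ∈ S, ∑ s ∈ f.support,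
          f.coeff s * c ^ s 0 * (Lagrange.nodalWeight S yCoord P * yCoord P ^ s 1) := by
        refine Finset.sum_congr rfl fun P hP => ?_
        rw [heval P hP, Finset.mul_sum]
        exact Finset.sum_congr rfl fun s _ => mul_left_comm _ _ _
    _ = ∑ s ∈ f.support, f.coeff s * c ^ s 0 *
          ∑ P ∈ S, Lagrange.nodalWeight S yCoord P * yCoord P ^ s 1 := by
        rw [Finset.sum_comm]
        simp only [Finset.mul_sum]
    _ = 0 := Finset.sum_eq_zero fun s hs => by
        have hsd := apply_one_lt_of_mem_support hq ha hf hs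
        rw [sum_nodalWeight_mul_pow_eq_zero hinj (by omega), mul_zero]

end VerticalWords

section DualCode

variable {K : Type*} [Field K] [Finite K] {q d a : ℕ}

theorem mem_dual_code_iff {v : B K q → K} :
    v ∈ LinCode.dual (code K q d a) ↔
      ∀ f ∈ forms K q d a, ∑ P, v P * eval (affineRep P.1) f = 0 := by
  constructor
  · exact fun h f hf => h _ ⟨f, hf, rfl⟩
  · rintro h _ ⟨f, hf, rfl⟩
    exact h f hf

theorem hammingNorm_eq_and_xCoord_eq_of_mem_dual_code [DecidableEq K] (hq : q ≠ 0) (haq : a ≤ q)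
    (had : a ≤ d) {v : B K q → K} (hv : v ∈ LinCode.dual (code K q d a))
    (hle : hammingNorm v ≤ d + 1) {P : B K q} (hP : v P ≠ 0) :
    hammingNorm v = d + 1 ∧ ∀ Q, v Q ≠ 0 → xCoord Q = xCoord P := by
  classical
  by_contra hvert
  let T : Finset (B K q) := ({Q | v Q ≠ 0} : Finset (B K q)).erase P
  have hT : #T + 1 = hammingNorm v := Finset.card_erase_add_one (by simpa using hP)
  have hmemT (Q : B K q) : Q ∈ T ↔ Q ≠ P ∧ v Q ≠ 0 := by simp [T]
  obtain ⟨f, hf, hfT, hfP⟩ : ∃ f ∈ forms K q d a, Separates f P T := by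
    refine exists_mem_forms_separates hq haq had (Finset.notMem_erase _ _) (by omega) fun hTd => ?_
    by_contra! hx
    refine hvert ⟨by omega, fun Q hQ => ?_⟩
    by_cases hQP : Q = P
    · rw [hQP]
    · exact hx Q ((hmemT Q).2 ⟨hQP, hQ⟩)
  exact hP (LinCode.apply_eq_zero_of_mem_dual hv ⟨f, hf, rfl⟩ hfP
    fun Q hQP hQ => hfT Q ((hmemT Q).2 ⟨hQP, hQ⟩))

theorem exists_mem_dual_code_support_eq (hq : q ≠ 0) (ha : a ≠ 0) {c : K} {S : Finset (B K q)}
    (hS : #S = d + 1) (hSc : ∀ P ∈ S, xCoord P = c) :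
    ∃ v ∈ LinCode.dual (code K q d a), ∀ P, v P ≠ 0 ↔ P ∈ S := by
  classical
  have hinj : Set.InjOn yCoord (S : Set (B K q)) := fun P hP Q hQ hy =>
    eq_of_coord_eq hq ((hSc P hP).trans (hSc Q hQ).symm) hy
  refine ⟨fun P => if P ∈ S then Lagrange.nodalWeight S yCoord P else 0,
    mem_dual_code_iff.2 fun f hf => ?_, fun P => ?_⟩
  · simpa [ite_mul, Finset.sum_ite_mem] using
      sum_nodalWeight_mul_eval_eq_zero hq ha hS hSc hinj hf
  · simpa using fun hP => Lagrange.nodalWeight_ne_zero hinj hP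

theorem exists_mem_dual_code_iff [DecidableEq K] (hq : q ≠ 0) (ha : a ≠ 0) (haq : a ≤ q)
    (had : a ≤ d) {H : Set (B K q)} :
    (∃ v ∈ LinCode.dual (code K q d a), v ≠ 0 ∧ hammingNorm v = d + 1 ∧ ∀ P ∈ H, v P = 0) ↔
      HasCollinear q (d + 1) H := by
  rw [hasCollinear_iff hq d.succ_pos]
  constructor
  · rintro ⟨v, hv, hv0, hvd, hvH⟩
    obtain ⟨P, hP⟩ := Function.ne_iff.1 hv0
    have hvert := (hammingNorm_eq_and_xCoord_eq_of_mem_dual_code hq haq had hv hvd.le hP).2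
    refine ⟨xCoord P, Finset.univ.filter (v · ≠ 0), hvd, fun Q hQ => ?_⟩
    have hvQ : v Q ≠ 0 := by simpa using hQ
    exact ⟨fun hQH => hvQ (hvH Q hQH), hvert Q hvQ⟩
  · rintro ⟨c, S, hS, hSc⟩
    obtain ⟨v, hv, hvS⟩ :=
      exists_mem_dual_code_support_eq hq ha hS fun P hP => (hSc P hP).2
    have hnorm : hammingNorm v = d + 1 := by
      refine (congrArg Finset.card (Finset.ext fun P => ?_)).trans hS
      simpa using hvS P
    refine ⟨v, hv, ?_, hnorm, fun P hPH => ?_⟩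
    · rw [← hammingNorm_ne_zero_iff, hnorm]
      exact d.succ_ne_zero
    · by_contra hvP
      exact (hSc P ((hvS P).1 hvP)).1 hPH

end DualCode

section Counting

variable {K : Type*} [Field K] [Fintype K] {q : ℕ}

theorem card_pow_add_mul_eq_le {R : Type*} [CommRing R] [IsDomain R] [Fintype R] [DecidableEq R]
    (hq : 1 < q) (a b : R) : #{y : R | y ^ q + a * y = b} ≤ q := by
  let r : Polynomial R := Polynomial.C a * Polynomial.X + Polynomial.C (-b)
  have hr : r.degree < q := Polynomial.degree_linear_le.trans_lt (by exact_mod_cast hq)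
  have hmonic : (Polynomial.X ^ q + r).Monic := Polynomial.monic_X_pow_add hr
  have hdeg : (Polynomial.X ^ q + r).natDegree = q := by
    refine Polynomial.natDegree_eq_of_degree_eq_some ?_
    rw [Polynomial.degree_add_eq_left_of_degree_lt, Polynomial.degree_X_pow]
    rwa [Polynomial.degree_X_pow]
  refine (Polynomial.card_le_degree_of_subset_roots fun y hy => ?_).trans hdeg.le
  have hy' : y ^ q + a * y = b := by simpa using hy
  rw [Polynomial.mem_roots hmonic.ne_zero]
  simp [r, Polynomial.IsRoot, ← hy']

theorem add_pow_of_card_eq_sq (hq : IsPrimePow q) (hK : Fintype.card K = q ^ 2) (x y : K) :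
    (x + y) ^ q = x ^ q + y ^ q := by
  obtain ⟨p, n, hp, -, rfl⟩ := hq
  have : Fact p.Prime := ⟨hp.nat_prime⟩
  have : CharP K p := charP_of_card_eq_prime_pow (hK.trans (pow_mul p n 2).symm)
  exact add_pow_char_pow x y p n

theorem pow_pow_of_card_eq_sq (hK : Fintype.card K = q ^ 2) (x : K) : (x ^ q) ^ q = x := by
  rw [← pow_mul, ← sq, ← hK, FiniteField.pow_card]

/-- The map `y ↦ y^q + y` sends the `q^2` elements of `K` to the at most `q` solutions of
`t^q = t`, and its fibres have at most `q` elements, so all these bounds are attained. -/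
theorem card_pow_add_self_eq [DecidableEq K] (hq : IsPrimePow q) (hK : Fintype.card K = q ^ 2)
    {t : K} (ht : t ^ q = t) : #{y : K | y ^ q + y = t} = q := by
  let F : Finset K := {t | t ^ q = t}
  have hF : #F ≤ q := by
    simpa [F, neg_one_mul, ← sub_eq_add_neg, sub_eq_zero] using
      card_pow_add_mul_eq_le hq.one_lt (-1 : K) 0
  have hfiber (s : K) : #{y : K | y ^ q + y = s} ≤ q := by
    simpa only [one_mul] using card_pow_add_mul_eq_le hq.one_lt 1 s
  have hmaps (y : K) : y ^ q + y ∈ F := by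
    simp [F, add_pow_of_card_eq_sq hq hK, pow_pow_of_card_eq_sq hK, add_comm]
  have hsum : ∑ s ∈ F, #{y : K | y ^ q + y = s} = ∑ _t ∈ F, q := by
    refine le_antisymm (Finset.sum_le_sum fun s _ => hfiber s) ?_
    calc ∑ _t ∈ F, q = #F * q := by rw [Finset.sum_const, smul_eq_mul]
      _ ≤ q ^ 2 := by rw [sq]; gcongr
      _ = ∑ s ∈ F, #{y : K | y ^ q + y = s} := by
        rw [← hK, ← Finset.card_univ, Finset.card_eq_sum_card_fiberwise fun y _ => hmaps y]
  exact (Finset.sum_eq_sum_iff_of_le fun s _ => hfiber s).1 hsum t (by simpa [F] using ht)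

theorem card_xCoord_eq [DecidableEq K] (hq : IsPrimePow q) (hK : Fintype.card K = q ^ 2) (c : K) :
    #{P : B K q | xCoord P = c} = q := by
  have hnorm : (c ^ (q + 1)) ^ q = c ^ (q + 1) := by
    rw [pow_succ, mul_pow, pow_pow_of_card_eq_sq hK, mul_comm]
  refine .trans ?_ (card_pow_add_self_eq hq hK hnorm)
  refine Finset.card_nbij yCoord (fun P hP => ?_) (fun P hP Q hQ hy => ?_) fun y hy => ?_
  · have hP : xCoord P = c := by simpa using hP
    simp [yCoord_pow_add_yCoord hq.ne_zero, hP]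
  · have hP : xCoord P = c := by simpa using hP
    have hQ : xCoord Q = c := by simpa using hQ
    exact eq_of_coord_eq hq.ne_zero (hP.trans hQ.symm) hy
  · obtain ⟨P, hx, hy⟩ := exists_coord_eq (q := q) (x := c) (y := y) (by simpa using hy)
    exact ⟨P, by simpa using hx, hy⟩

theorem hasCollinear_empty (hq : IsPrimePow q) (hK : Fintype.card K = q ^ 2) {m : ℕ} (hm : 0 < m)
    (hmq : m ≤ q) : HasCollinear q m (∅ : Set (B K q)) := by
  classical
  obtain ⟨S, hS, hSm⟩ := Finset.exists_subset_card_eq (hmq.trans_eq (card_xCoord_eq hq hK 0).symm)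
  refine (hasCollinear_iff hq.ne_zero hm).2 ⟨0, S, hSm, fun P hP => ⟨Set.notMem_empty P, ?_⟩⟩
  simpa using hS hP

theorem card_B (hq : IsPrimePow q) (hK : Fintype.card K = q ^ 2) :
    Nat.card (B K q) = q ^ 2 * q := by
  classical
  rw [Nat.card_eq_fintype_card, ← Finset.card_univ,
    Finset.card_eq_sum_card_fiberwise fun P _ => Finset.mem_univ (xCoord P),
    Finset.sum_congr rfl fun c _ => card_xCoord_eq hq hK c, Finset.sum_const, Finset.card_univ,
    hK, smul_eq_mul]

theorem ncard_compl_le_of_not_hasCollinear (hq : q ≠ 0) {m : ℕ} {H : Set (B K q)}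
    (h : ¬HasCollinear q (m + 1) H) : Hᶜ.ncard ≤ Fintype.card K * m := by
  classical
  rw [Set.ncard_eq_toFinset_card', mul_comm]
  refine Finset.card_le_mul_card_image_of_maps_to (f := xCoord) (t := Finset.univ)
    (fun _ _ => Finset.mem_univ _) m fun c _ => ?_
  by_contra! hlt
  obtain ⟨S, hS, hSm⟩ := Finset.exists_subset_card_eq (Nat.succ_le_of_lt hlt)
  refine h ((hasCollinear_iff hq m.succ_pos).2 ⟨c, S, hSm, fun P hP => ?_⟩)
  simpa using hS hP

end Counting

section ImprovingSubsets

variable {K : Type*} [Field K] [Fintype K] {q d a : ℕ}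

theorem minDist_dual_code (hq : IsPrimePow q) (hK : Fintype.card K = q ^ 2) (hdq : d < q)
    (ha : a ≠ 0) (had : a ≤ d) :
    LinCode.minDist (LinCode.dual (code K q d a)) = (d + 1 : ℕ) := by
  classical
  have haq : a ≤ q := had.trans hdq.le
  refine le_antisymm ?_ (LinCode.le_minDist_iff.2 fun v hv hv0 => ?_)
  · obtain ⟨v, hv, hv0, hvd, -⟩ := (exists_mem_dual_code_iff hq.ne_zero ha haq had).2
      (hasCollinear_empty hq hK d.succ_pos hdq)
    exact hvd ▸ LinCode.le_minDist_iff.1 le_rfl v hv hv0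
  · obtain ⟨P, hP⟩ := Function.ne_iff.1 hv0
    by_contra! hlt
    have hlt' := Nat.cast_lt.1 hlt
    exact hlt'.ne
      (hammingNorm_eq_and_xCoord_eq_of_mem_dual_code hq.ne_zero haq had hv hlt'.le hP).1

theorem isImprovingSubset_code_iff (hq : IsPrimePow q) (hK : Fintype.card K = q ^ 2) (hdq : d < q)
    (ha : a ≠ 0) (had : a ≤ d) {H : Set (B K q)} (hH : H.Nonempty) :
    LinCode.IsImprovingSubset (code K q d a) H ↔ ¬HasCollinear q (d + 1) H := by
  classical
  rw [LinCode.isImprovingSubset_iff_of_minDist_eq (minDist_dual_code hq hK hdq ha had) hH,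
    ← exists_mem_dual_code_iff hq.ne_zero ha (had.trans hdq.le) had]
  push Not
  rfl

end ImprovingSubsets

end Hermitian

theorem corollary6p5 {K : Type*} [Field K] [Fintype K] (q : ℕ) (hq : IsPrimePow q)
    (hK : Fintype.card K = q ^ 2) (d a : ℕ) (hd : 0 < d) (hdq : d < q) (ha : 1 ≤ a) (had : a ≤ d)
    (H : Set (Hermitian.B K q)) [DecidablePred (· ∈ H)] (hH : H.Nonempty) :
    (LinCode.IsImprovingSubset (Hermitian.code K q d a) H ↔
      ¬ Hermitian.HasCollinear q (d + 1) H) ∧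
    (LinCode.IsImprovingSubset (Hermitian.code K q d a) H →
      q ^ 2 * (q - d) ≤ H.ncard ∧
      LinCode.length (LinCode.dual (Hermitian.codeH q d a H)) ≤ q ^ 2 * d) := by
  have himproving :=
    Hermitian.isImprovingSubset_code_iff hq hK hdq (Nat.one_le_iff_ne_zero.1 ha) had hH
  refine ⟨himproving, fun h => ?_⟩
  have hcompl : Hᶜ.ncard ≤ q ^ 2 * d :=
    hK ▸ Hermitian.ncard_compl_le_of_not_hasCollinear hq.ne_zero (himproving.1 h)
  have hcard : H.ncard + Hᶜ.ncard = q ^ 2 * q :=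
    (Set.ncard_add_ncard_compl H).trans (Hermitian.card_B hq hK)
  refine ⟨?_, (Nat.card_coe_set_eq Hᶜ).trans_le hcompl⟩
  rw [Nat.mul_sub]
  omega
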